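/- **The game.** Let $G$ be a finite simple graph, $F\subseteq V(G)$ and $b\ge 0$. On turn $0$ the vertices of $F$ burn and each of $b$ firefighters is placed on a vertex outside $F$. On every later turn, first the fire spreads from the burnt vertices to all their neighbours that have not been protected, and then each firefighter moves (or stays) along a walk of $G$, of arbitrary length ($d=\infty$), all of whose vertices are unburnt at that moment (several firefighters may share a vertex). Every vertex on which a firefighter stands at the end of a turn is protected forever, and burnt vertices remain burnt. Let $\mathrm{DPRMVS}(G,F;b,\infty)$ be the maximum, over all strategies of the firefighters, of the number of vertices that never burn. The path-restricted expected damage with $q$ fires and $b$ firefighters is $$E_{pr}(G;q,b,\infty)=\sum_{F\subseteq V(G),\ |F|=q}\frac{|V(G)|-\mathrm{DPRMVS}(G,F;b,\infty)}{\binom{|V(G)|}{q}} .$$ **Theorem.** Let $b\ge 1$, let $G_A$ be a finite connected graph on at least $b+1$ vertices and $G_B$ a connected graph on exactly $b+1$ vertices. Number the vertices of $G_B$ by $1,\dots,b+1$, and number the vertices of some $(b+1)$-subset of $V(G_A)$ likewise. For an integer $\ell>0$, let $G_\ell$ be the graph obtained from the disjoint union of $G_A$ and $G_B$ by joining, for each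 $i$, the vertex of $G_A$ labelled $i$ to the vertex of $G_B$ labelled $i$ by a path with $\ell$ new internal vertices (the $b+1$ paths have disjoint sets of internal vertices), and let $G_\ell-E(G_B)$ be its spanning subgraph obtained by deleting the edges of $G_B$. Then, for $b$, $G_A$, $G_B$ and the labellings fixed: 1. for all sufficiently large $\ell$, $E_{pr}(G_\ell;b,b,\infty)<E_{pr}(G_\ell-E(G_B);b,b,\infty)$; 2. $\displaystyle \frac{E_{pr}(G_\ell-E(G_B);b,b,\infty)}{E_{pr}(G_\ell;b,b,\infty)}\to\infty$ as $\ell\to\infty$; 3. as $\ell\to\infty$, $\displaystyle \binom{|V(G_\ell)|}{b}E_{pr}(G_\ell;b,b,\infty)=O(\ell^{b})$ and $\displaystyle \binom{|V(G_\ell)|}{b}E_{pr}(G_\ell-E(G_B);b,b,\infty)=\Omega(\ell^{b+1})$. -/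

import Mathlib

namespace Firefighter

/-- A placement of `b` firefighters for every turn: `p t i` is the vertex that firefighter `i`
occupies (and protects) on turn `t`. Firefighters may share a vertex and may stay where they are.
Since the fire spreads deterministically, a strategy against a fixed set of initial fires is
such a sequence of placements. -/
abbrev Placement (V : Type*) (b : ℕ) : Type _ := ℕ → Fin b → V

/-- The vertices protected by the end of turn `t`; protection is permanent. -/
def defended {V : Type*} {b : ℕ} (p : Placement V b) (t : ℕ) : Set V :=
  {v | ∃ s ≤ t, ∃ i, p s i = v}

/-- The vertices burnt at turn `t`. On turn `0` these are the initial fires `F`; on every later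
turn, before the firefighters move, the fire spreads to all neighbours of burnt vertices that
are not yet protected. -/
def burnt {V : Type*} (G : SimpleGraph V) (F : Set V) {b : ℕ} (p : Placement V b) : ℕ → Set V
  | 0 => F
  | t + 1 => burnt G F p t ∪ {v | v ∉ defended p t ∧ ∃ u ∈ burnt G F p t, G.Adj u v}

/-- A firefighter can move from `u` to `v` without passing through the burnt set `B`, along at
most `d` edges (for `d = ⊤` the length is unrestricted, but a walk is still required). -/
def CanMove {V : Type*} (G : SimpleGraph V) (B : Set V) (d : ℕ∞) (u v : V) : Prop :=
  ∃ w : G.Walk u v, (w.length : ℕ∞) ≤ d ∧ ∀ x ∈ w.support, x ∉ B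

/-- The legal strategies of the distance-path-restricted game: the firefighters are first placed
anywhere outside the fire, and on each later turn, after the fire has spread, each of them moves
a distance at most `d` within the subgraph induced by the unburnt vertices. -/
def IsLegal {V : Type*} (G : SimpleGraph V) (F : Set V) {b : ℕ} (d : ℕ∞)
    (p : Placement V b) : Prop :=
  (∀ i, p 0 i ∉ F) ∧ ∀ t i, CanMove G (burnt G F p (t + 1)) d (p t i) (p (t + 1) i)

/-- The vertices that never burn. -/
def saved {V : Type*} (G : SimpleGraph V) (F : Set V) {b : ℕ} (p : Placement V b) : Set V :=
  {v | ∀ t, v ∉ burnt G F p t}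

/-- `DPRMVS(G, F; b, d)`: the maximum number of vertices of a finite graph that `b` firefighters
can save in the distance-path-restricted game with initial fires `F`. -/
noncomputable def dprmvs {V : Type*} (G : SimpleGraph V) (F : Set V) (b : ℕ) (d : ℕ∞) : ℕ :=
  sSup {k | ∃ p : Placement V b, IsLegal G F d p ∧ (saved G F p).ncard = k}

/-- `E_pr(G; q, b, d)`: the path-restricted expected damage with `q` initial fires (a uniformly
random `q`-subset of the vertices) and `b` firefighters. -/
noncomputable def expectedDamagePR {V : Type*} [Fintype V] (G : SimpleGraph V)
    (q b : ℕ) (d : ℕ∞) : ℝ :=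
  ∑ F ∈ (Finset.univ : Finset V).powersetCard q,
    ((Fintype.card V : ℝ) - (dprmvs G (F : Set V) b d : ℝ)) / ((Fintype.card V).choose q : ℝ)

/-- Vertices of `G_ℓ`: those of `G_A`, then `ℓ` internal vertices for each of the `m` connecting
paths, then those of `G_B`. -/
abbrev JoinVertex (VA VB : Type*) (m ℓ : ℕ) : Type _ := VA ⊕ (Fin m × Fin ℓ) ⊕ VB

/-- The edges of `G_ℓ` (each listed in at least one direction): those of `G_A` and `G_B`, and
for each label `i` those of the path
`labA i, (i, 0), (i, 1), …, (i, ℓ - 1), labB i` with `ℓ` internal vertices. -/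
inductive JoinEdge {VA VB : Type*} (GA : SimpleGraph VA) (GB : SimpleGraph VB) {m : ℕ}
    (labA : Fin m → VA) (labB : Fin m → VB) (ℓ : ℕ) :
    JoinVertex VA VB m ℓ → JoinVertex VA VB m ℓ → Prop
  | inA {u v : VA} (h : GA.Adj u v) : JoinEdge GA GB labA labB ℓ (Sum.inl u) (Sum.inl v)
  | inB {u v : VB} (h : GB.Adj u v) :
      JoinEdge GA GB labA labB ℓ (Sum.inr (Sum.inr u)) (Sum.inr (Sum.inr v))
  | direct (i : Fin m) (h : ℓ = 0) :
      JoinEdge GA GB labA labB ℓ (Sum.inl (labA i)) (Sum.inr (Sum.inr (labB i)))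
  | first (i : Fin m) (k : Fin ℓ) (h : (k : ℕ) = 0) :
      JoinEdge GA GB labA labB ℓ (Sum.inl (labA i)) (Sum.inr (Sum.inl (i, k)))
  | step (i : Fin m) (k k' : Fin ℓ) (h : (k' : ℕ) = k + 1) :
      JoinEdge GA GB labA labB ℓ (Sum.inr (Sum.inl (i, k))) (Sum.inr (Sum.inl (i, k')))
  | last (i : Fin m) (k : Fin ℓ) (h : (k : ℕ) + 1 = ℓ) :
      JoinEdge GA GB labA labB ℓ (Sum.inr (Sum.inl (i, k))) (Sum.inr (Sum.inr (labB i)))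

/-- The graph `G_ℓ`: `G_A` and `G_B` with equally labelled vertices joined by a path with `ℓ`
internal vertices. -/
def joinGraph {VA VB : Type*} (GA : SimpleGraph VA) (GB : SimpleGraph VB) {m : ℕ}
    (labA : Fin m → VA) (labB : Fin m → VB) (ℓ : ℕ) : SimpleGraph (JoinVertex VA VB m ℓ) :=
  SimpleGraph.fromRel (JoinEdge GA GB labA labB ℓ)

/-- The spanning subgraph `G_ℓ - E(G_B)`: all vertices are kept, the edges of `G_B` removed. -/
def joinGraphMinusB {VA VB : Type*} (GA : SimpleGraph VA) (GB : SimpleGraph VB) {m : ℕ}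
    (labA : Fin m → VA) (labB : Fin m → VB) (ℓ : ℕ) : SimpleGraph (JoinVertex VA VB m ℓ) :=
  (joinGraph GA GB labA labB ℓ).deleteEdges
    (Sym2.map (fun v : VB => (Sum.inr (Sum.inr v) : JoinVertex VA VB m ℓ)) '' GB.edgeSet)

end Firefighter

/-!
Write `n` for the number of vertices of `G_ℓ`, which is linear in `ℓ`. After multiplication by
`n.choose b` the expected damage is the sum, over all sets `F` of `b` fires, of the number of burnt
vertices under optimal play.

In `G_ℓ`, call `F` spread out if all fires are inside the connecting paths, not too close to the ends
or to each other. Then `b` firefighters lose at most `2 * b` vertices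
(`damage_joinGraph_le_of_spread`): each path is cut by its fires into segments, and a firefighter
placed above a fire has one turn to get to the lower side of the next fire of its path. The
firefighter above the topmost fire has to go below the lowest one, and can do so through the
connected graphs `G_A` and `G_B`, because one of the `b + 1` paths carries no fire. A set which is not
spread out arises from a set of `b - 1` fires by adding one of boundedly many vertices, so there are
only `O(n ^ (b - 1))` of these (`card_le_of_forall_exists`), each with damage at most `n`. The sum is
`O(ℓ ^ b)` (`sum_damage_joinGraph_le`).

In `G_ℓ - E(G_B)` the connecting paths are pendant. Put one fire in the middle third of each of the
first `b` paths. The complement of the fires consists of `b` outer ends and a central part, with no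
way between these regions, so one of them never contains any of the `b` firefighters and loses at
least `ℓ / 3` vertices (`le_damage_joinGraphMinusB`). There are `(ℓ / 3) ^ b` such sets of fires,
so the sum is `Ω(ℓ ^ (b + 1))` (`pow_le_sum_damage_joinGraphMinusB`).

The remaining claims follow by division, since the expected damage in `G_ℓ` is positive.
-/

namespace Firefighter

/-! ### Moves and the spread of the fire -/

section Game

variable {V : Type*} {G : SimpleGraph V} {B : Set V}

theorem CanMove.refl {u : V} (hu : u ∉ B) : CanMove G B ⊤ u u :=
  ⟨.nil, le_top, by simpa using hu⟩

theorem CanMove.symm {u v : V} (h : CanMove G B ⊤ u v) : CanMove G B ⊤ v u := by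
  obtain ⟨w, -, hw⟩ := h
  exact ⟨w.reverse, le_top, by simpa using hw⟩

theorem CanMove.trans {u v w : V} (h : CanMove G B ⊤ u v) (h' : CanMove G B ⊤ v w) :
    CanMove G B ⊤ u w := by
  obtain ⟨p, -, hp⟩ := h
  obtain ⟨q, -, hq⟩ := h'
  refine ⟨p.append q, le_top, fun x hx => ?_⟩
  rcases SimpleGraph.Walk.mem_support_append_iff _ _ |>.1 hx with hx | hx
  exacts [hp x hx, hq x hx]

theorem CanMove.of_adj {u v : V} (hu : u ∉ B) (hv : v ∉ B) (h : G.Adj u v) :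
    CanMove G B ⊤ u v :=
  ⟨.cons h .nil, le_top, by simpa using ⟨hu, hv⟩⟩

theorem CanMove.anti {B' : Set V} {d : ℕ∞} {u v : V} (hB : B ⊆ B') (h : CanMove G B' d u v) :
    CanMove G B d u v := by
  obtain ⟨w, hl, hw⟩ := h
  exact ⟨w, hl, fun x hx hxB => hw x hx (hB hxB)⟩

theorem CanMove.of_seq (f : ℕ → V) {m n : ℕ} (hmn : m ≤ n)
    (hadj : ∀ k, m ≤ k → k < n → G.Adj (f k) (f (k + 1)))
    (hB : ∀ k, m ≤ k → k ≤ n → f k ∉ B) : CanMove G B ⊤ (f m) (f n) := by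
  induction n, hmn using Nat.le_induction with
  | base => exact .refl (hB m le_rfl le_rfl)
  | succ n hmn ih =>
    exact (ih (fun k h h' => hadj k h (by omega)) (fun k h h' => hB k h (by omega))).trans
      (.of_adj (hB n hmn (by omega)) (hB _ (by omega) le_rfl) (hadj n hmn (by omega)))

theorem CanMove.of_hom {W : Type*} {H : SimpleGraph W} (φ : H →g G) (hH : H.Preconnected)
    (hB : ∀ x, φ x ∉ B) (u v : W) : CanMove G B ⊤ (φ u) (φ v) := by
  obtain ⟨w⟩ := hH u v
  refine ⟨w.map φ, le_top, fun x hx => ?_⟩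
  rw [SimpleGraph.Walk.support_map, List.mem_map] at hx
  obtain ⟨y, -, rfl⟩ := hx
  exact hB y

variable {F : Set V} {b : ℕ} {p : Placement V b}

theorem burnt_mono (G : SimpleGraph V) (F : Set V) (p : Placement V b) : Monotone (burnt G F p) :=
  monotone_nat_of_le_succ fun _ => Set.subset_union_left

theorem subset_burnt (G : SimpleGraph V) (F : Set V) (p : Placement V b) (t : ℕ) :
    F ⊆ burnt G F p t :=
  burnt_mono G F p (Nat.zero_le t)

/-- Firefighters never enter a region all of whose exits are fires if none of them starts there. -/
theorem IsLegal.notMem_of_enclosed {d : ℕ∞} (hp : IsLegal G F d p) {C : Set V}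
    (hC : ∀ u ∈ C, ∀ v, G.Adj u v → v ∈ C ∨ v ∈ F) (h0 : ∀ i, p 0 i ∉ C) (t : ℕ) (i : Fin b) :
    p t i ∉ C := by
  induction t with
  | zero => exact h0 i
  | succ t ih =>
    obtain ⟨w, -, hw⟩ := hp.2 t i
    have key : ∀ {u v : V} (w : G.Walk u v), (∀ x ∈ w.support, x ∉ F) → u ∉ C → v ∉ C := by
      intro u v w
      induction w with
      | nil => exact fun _ h => h
      | cons h w ih =>
        intro hF hu
        refine ih (fun x hx => hF x (by simp [hx])) fun hv => ?_
        rcases hC _ hv _ h.symm with h' | h'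
        exacts [hu h', hF _ (by simp) h']
    exact key w (fun x hx hxF => hw x hx (subset_burnt G F p _ hxF)) ih

/-- In a region that firefighters never enter, the fire runs along every path unhindered. -/
theorem mem_burnt_of_seq {C : Set V} (hpC : ∀ t i, p t i ∉ C) (f : ℕ → V) (h0 : f 0 ∈ F) (n : ℕ)
    (hf : ∀ k < n, G.Adj (f k) (f (k + 1)) ∧ f (k + 1) ∈ C) : f n ∈ burnt G F p n := by
  induction n with
  | zero => exact h0
  | succ n ih =>
    refine Or.inr ⟨?_, f n, ih fun k hk => hf k (by omega), (hf n (by omega)).1⟩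
    rintro ⟨s, -, i, hs⟩
    exact hpC s i (hs ▸ (hf n (by omega)).2)

/-! ### Bounds on the number of saved vertices -/

variable [Fintype V]

/-- If every legal strategy loses at least `k` vertices, so does the best one. The bound on `k`
covers a position without legal strategies, where `dprmvs` is `0`. -/
theorem dprmvs_add_le {d : ℕ∞} {k : ℕ} (hk : k ≤ Fintype.card V)
    (h : ∀ p : Placement V b, IsLegal G F d p →
      ∃ S : Finset V, k ≤ S.card ∧ ∀ v ∈ S, ∃ t, v ∈ burnt G F p t) :
    dprmvs G F b d + k ≤ Fintype.card V := by
  classical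
  suffices dprmvs G F b d ≤ Fintype.card V - k by omega
  refine csSup_le' ?_
  rintro _ ⟨p, hp, rfl⟩
  obtain ⟨S, hS, hb⟩ := h p hp
  have hsub : saved G F p ⊆ ((Sᶜ : Finset V) : Set V) := by
    intro v hv
    simp only [Finset.coe_compl, Set.mem_compl_iff, Finset.mem_coe]
    intro hvS
    obtain ⟨t, ht⟩ := hb v hvS
    exact hv t ht
  have h1 := Set.ncard_le_ncard hsub (Finset.finite_toSet _)
  rw [Set.ncard_coe_finset, Finset.card_compl] at h1
  omega

/-- A strategy that confines the fire to `S` saves all vertices outside `S`. -/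
theorem card_le_dprmvs_add {d : ℕ∞} (hp : IsLegal G F d p) (S : Finset V)
    (h : ∀ t, burnt G F p t ⊆ S) : Fintype.card V ≤ dprmvs G F b d + S.card := by
  classical
  have h1 : (saved G F p).ncard ≤ dprmvs G F b d := by
    refine le_csSup ⟨Fintype.card V, ?_⟩ ⟨p, hp, rfl⟩
    rintro _ ⟨p, -, rfl⟩
    rw [← Nat.card_eq_fintype_card]
    exact Set.ncard_le_card _
  have hsub : ((Sᶜ : Finset V) : Set V) ⊆ saved G F p := by
    intro v hv t ht
    simp only [Finset.coe_compl, Set.mem_compl_iff, Finset.mem_coe] at hv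
    exact hv (h t ht)
  have h2 := Set.ncard_le_ncard hsub (Set.toFinite _)
  rw [Set.ncard_coe_finset, Finset.card_compl] at h2
  omega

theorem dprmvs_le_card (G : SimpleGraph V) (F : Set V) (b : ℕ) (d : ℕ∞) :
    dprmvs G F b d ≤ Fintype.card V :=
  dprmvs_add_le (k := 0) (Nat.zero_le _) fun _ _ => ⟨∅, le_rfl, by simp⟩

/-- The initial fires themselves always burn. -/
theorem dprmvs_add_card_le (G : SimpleGraph V) (F : Finset V) (b : ℕ) (d : ℕ∞) :
    dprmvs G (F : Set V) b d + F.card ≤ Fintype.card V :=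
  dprmvs_add_le F.card_le_univ fun _ _ => ⟨F, le_rfl, fun _ hv => ⟨0, hv⟩⟩

/-- The number of vertices that burn when `b` firefighters without a limit on their speed play
optimally. The subtraction does not truncate, by `dprmvs_le_card`. -/
noncomputable def damage (G : SimpleGraph V) (F : Set V) (b : ℕ) : ℕ :=
  Fintype.card V - dprmvs G F b ⊤

theorem choose_mul_expectedDamagePR (G : SimpleGraph V) {q b : ℕ} (hq : q ≤ Fintype.card V) :
    ((Fintype.card V).choose q : ℝ) * expectedDamagePR G q b ⊤ =
      ((∑ F ∈ (Finset.univ : Finset V).powersetCard q, damage G (F : Set V) b : ℕ) : ℝ) := by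
  have h0 : ((Fintype.card V).choose q : ℝ) ≠ 0 := by
    exact_mod_cast (Nat.choose_pos hq).ne'
  rw [expectedDamagePR, Finset.mul_sum, Nat.cast_sum]
  refine Finset.sum_congr rfl fun F _ => ?_
  rw [damage, Nat.cast_sub (dprmvs_le_card G _ b ⊤)]
  field_simp

theorem choose_mul_expectedDamagePR_pos (G : SimpleGraph V) {q b : ℕ} (hq0 : 1 ≤ q)
    (hq : q ≤ Fintype.card V) :
    0 < ((Fintype.card V).choose q : ℝ) * expectedDamagePR G q b ⊤ := by
  rw [choose_mul_expectedDamagePR G hq, Nat.cast_pos]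
  refine Finset.sum_pos (fun F hF => ?_) (Finset.powersetCard_nonempty.2 (by simpa using hq))
  have := dprmvs_add_card_le G F b ⊤
  rw [(Finset.mem_powersetCard.1 hF).2] at this
  rw [damage]
  omega

end Game

/-! ### Counting atypical sets, and cyclic successors -/

section Counting

variable {V : Type*} [Fintype V] [DecidableEq V]

/-- The number of `q`-sets containing an element of `S`, or two elements one of which lies in `N`
of the other, is of lower order than the number of all `q`-sets: such a set arises from a
`(q - 1)`-set by adding one of boundedly many elements. -/
theorem card_le_of_forall_exists {q : ℕ} (hq : 1 ≤ q) (S : Finset V) (N : V → Finset V) {c : ℕ}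
    (hN : ∀ v, (N v).card ≤ c) (T : Finset (Finset V))
    (hT : ∀ F ∈ T, F.card = q ∧ ∃ v ∈ F, v ∈ S ∨ ∃ u ∈ F, u ≠ v ∧ v ∈ N u) :
    T.card ≤ Fintype.card V ^ (q - 1) * (S.card + (q - 1) * c) := by
  obtain ⟨q, rfl⟩ := Nat.exists_eq_add_of_le' hq
  rw [Nat.add_sub_cancel]
  have hsub : T ⊆ ((Finset.univ : Finset V).powersetCard q).biUnion
      fun F => (S ∪ F.biUnion N).image fun v => insert v F := by
    intro F hF
    obtain ⟨hc, v, hv, h⟩ := hT F hF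
    refine Finset.mem_biUnion.2 ⟨F.erase v, ?_, Finset.mem_image.2 ⟨v, ?_, ?_⟩⟩
    · simp [Finset.mem_powersetCard, Finset.card_erase_of_mem hv, hc]
    · rcases h with h | ⟨u, hu, huv, h⟩
      · exact Finset.mem_union_left _ h
      · exact Finset.mem_union_right _
          (Finset.mem_biUnion.2 ⟨u, Finset.mem_erase.2 ⟨huv, hu⟩, h⟩)
    · exact Finset.insert_erase hv
  refine (Finset.card_le_card hsub).trans ((Finset.card_biUnion_le_card_mul _ _
    (S.card + q * c) fun F hF => ?_).trans ?_)
  · refine Finset.card_image_le.trans ((Finset.card_union_le _ _).trans ?_)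
    rw [← (Finset.mem_powersetCard.1 hF).2]
    exact Nat.add_le_add_left (Finset.card_biUnion_le_card_mul _ _ _ fun v _ => hN v) _
  · rw [Finset.card_powersetCard, Finset.card_univ]
    exact Nat.mul_le_mul_right _ (Nat.choose_le_pow _ _)

/-- For a finite set of natural numbers, the map to the next larger element, the largest element
going to the smallest one, is an injective map of the set to itself. -/
theorem exists_cyclic_succ (A : Finset ℕ) :
    ∃ s : ℕ → ℕ, (∀ a ∈ A, s a ∈ A) ∧ (∀ a ∈ A, ∀ a' ∈ A, s a = s a' → a = a') ∧
      ∀ a ∈ A, (a < s a ∧ ∀ c ∈ A, c ≤ a ∨ s a ≤ c) ∨ ∀ c ∈ A, s a ≤ c ∧ c ≤ a := by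
  have key : ∀ a, ∃ a', a ∈ A →
      a' ∈ A ∧ ((a < a' ∧ ∀ c ∈ A, c ≤ a ∨ a' ≤ c) ∨ ∀ c ∈ A, a' ≤ c ∧ c ≤ a) := by
    intro a
    by_cases h : (A.filter (a < ·)).Nonempty
    · have hm := Finset.mem_filter.1 (Finset.min'_mem _ h)
      refine ⟨_, fun _ => ⟨hm.1, .inl ⟨hm.2, fun c hc => ?_⟩⟩⟩
      by_contra! hcon
      exact hcon.2.not_ge (Finset.min'_le _ _ (Finset.mem_filter.2 ⟨hc, hcon.1⟩))
    · by_cases hA : A.Nonempty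
      · refine ⟨A.min' hA, fun _ => ⟨A.min'_mem hA, .inr fun c hc => ⟨A.min'_le c hc, ?_⟩⟩⟩
        by_contra! hcon
        exact h ⟨c, Finset.mem_filter.2 ⟨hc, hcon⟩⟩
      · exact ⟨0, fun ha => (hA ⟨a, ha⟩).elim⟩
  choose s hs using key
  refine ⟨s, fun a ha => (hs a ha).1, fun a ha a' ha' heq => ?_, fun a ha => (hs a ha).2⟩
  have h1 := (hs a ha).2
  have h2 := (hs a' ha').2
  rcases h1 with ⟨h1, h1'⟩ | h1 <;> rcases h2 with ⟨h2, h2'⟩ | h2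
  · have := h1' a' ha'
    have := h2' a ha
    omega
  · have := h2 a ha
    omega
  · have := h1 a' ha'
    omega
  · have := h1 a' ha'
    have := h2 a ha
    omega

end Counting

/-! ### The vertices of the connecting paths -/

section PathVertices

variable {VA VB : Type*} {m : ℕ} (labA : Fin m → VA) (labB : Fin m → VB) (ℓ : ℕ)

/-- The `k`-th vertex of the `i`-th connecting path, ends included: `labA i` for `k = 0`, the
internal vertices for `1 ≤ k ≤ ℓ`, and `labB i` from `k = ℓ + 1` on. -/
def pathVertex (i : Fin m) : ℕ → JoinVertex VA VB m ℓ
  | 0 => Sum.inl (labA i)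
  | k + 1 => if h : k < ℓ then Sum.inr (Sum.inl (i, ⟨k, h⟩)) else Sum.inr (Sum.inr (labB i))

variable {labA labB ℓ}

theorem pathVertex_interior (i : Fin m) {k : ℕ} (h : k < ℓ) :
    pathVertex labA labB ℓ i (k + 1) = Sum.inr (Sum.inl (i, ⟨k, h⟩)) := dif_pos h

theorem pathVertex_last (i : Fin m) :
    pathVertex labA labB ℓ i (ℓ + 1) = Sum.inr (Sum.inr (labB i)) := dif_neg (lt_irrefl ℓ)

theorem pathVertex_inj_interior {i j : Fin m} {k k' : ℕ} (hk : k ≤ ℓ + 1) (h1 : 1 ≤ k')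
    (h2 : k' ≤ ℓ) (h : pathVertex labA labB ℓ i k = pathVertex labA labB ℓ j k') :
    i = j ∧ k = k' := by
  obtain ⟨k', rfl⟩ := Nat.exists_eq_add_of_le' h1
  rw [pathVertex_interior j h2] at h
  cases k with
  | zero => simp [pathVertex] at h
  | succ k =>
    by_cases hkl : k < ℓ
    · rw [pathVertex_interior i hkl] at h
      simpa using h
    · simp [pathVertex, hkl] at h

theorem pathVertex_inj (hB : Function.Injective labB) {i j : Fin m} {k k' : ℕ} (hk : k ≤ ℓ + 1)
    (h1 : 1 ≤ k') (h2 : k' ≤ ℓ + 1)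
    (h : pathVertex labA labB ℓ i k = pathVertex labA labB ℓ j k') : i = j ∧ k = k' := by
  rcases h2.lt_or_eq with h2 | rfl
  · exact pathVertex_inj_interior hk h1 (by omega) h
  · rcases hk.lt_or_eq with hk | rfl
    · cases k with
      | zero => simp [pathVertex] at h
      | succ k =>
        rw [pathVertex_interior i (by omega), pathVertex_last] at h
        simp at h
    · rw [pathVertex_last, pathVertex_last] at h
      simpa using hB (by simpa using h)

variable {GA : SimpleGraph VA} {GB : SimpleGraph VB}

theorem joinGraphMinusB_le : joinGraphMinusB GA GB labA labB ℓ ≤ joinGraph GA GB labA labB ℓ :=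
  SimpleGraph.deleteEdges_le _

theorem joinGraphMinusB_adj_pathVertex (i : Fin m) {k : ℕ} (hk : k ≤ ℓ) :
    (joinGraphMinusB GA GB labA labB ℓ).Adj (pathVertex labA labB ℓ i k)
      (pathVertex labA labB ℓ i (k + 1)) := by
  rw [joinGraphMinusB, SimpleGraph.deleteEdges_adj, joinGraph, SimpleGraph.fromRel_adj]
  cases k with
  | zero =>
    rcases hk.eq_or_lt with h | h
    · have h0 : ¬ 0 < ℓ := by omega
      simp only [pathVertex, h0, dite_false]
      refine ⟨⟨by simp, .inl (.direct i h.symm)⟩, ?_⟩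
      rintro ⟨e, -, he⟩
      induction e with | _ x y => simp at he
    · rw [pathVertex_interior i h]
      refine ⟨⟨by simp [pathVertex], .inl (.first i ⟨0, h⟩ rfl)⟩, ?_⟩
      rintro ⟨e, -, he⟩
      induction e with | _ x y => simp at he
  | succ k =>
    rw [pathVertex_interior i hk]
    rcases hk.eq_or_lt with h | h
    · subst h
      rw [pathVertex_last]
      refine ⟨⟨by simp, .inl (.last i ⟨k, hk⟩ rfl)⟩, ?_⟩
      rintro ⟨e, -, he⟩
      induction e with | _ x y => simp at he
    · rw [pathVertex_interior i h]
      refine ⟨⟨by simp, .inl (.step i ⟨k, hk⟩ ⟨k + 1, h⟩ rfl)⟩, ?_⟩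
      rintro ⟨e, -, he⟩
      induction e with | _ x y => simp at he

/-- An internal vertex of a connecting path has no neighbours outside this path. -/
theorem eq_or_eq_of_adj_pathVertex {i : Fin m} {k : ℕ} (h1 : 1 ≤ k) (h2 : k ≤ ℓ)
    {v : JoinVertex VA VB m ℓ}
    (h : (joinGraph GA GB labA labB ℓ).Adj (pathVertex labA labB ℓ i k) v) :
    v = pathVertex labA labB ℓ i (k - 1) ∨ v = pathVertex labA labB ℓ i (k + 1) := by
  obtain ⟨k, rfl⟩ := Nat.exists_eq_add_of_le' h1
  rw [pathVertex_interior i h2, joinGraph, SimpleGraph.fromRel_adj] at h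
  rw [Nat.add_sub_cancel]
  obtain ⟨-, h⟩ := h
  rcases h with h | h
  · cases h with
    | step _ _ k' h =>
      right
      have hk : k + 1 < ℓ := h ▸ k'.2
      obtain rfl : k' = ⟨k + 1, hk⟩ := Fin.ext h
      rw [pathVertex_interior i hk]
    | last _ _ h =>
      right
      obtain rfl : ℓ = k + 1 := h.symm
      rw [pathVertex_last]
  · cases h with
    | first _ _ h =>
      left
      obtain rfl : k = 0 := h
      rfl
    | step _ k' _ h =>
      left
      obtain rfl : k = k' + 1 := h
      rw [pathVertex_interior i k'.2]

/-- Without the edges of `G_B`, the vertices of `G_B` are ends of pendant paths. -/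
theorem eq_of_joinGraphMinusB_adj_last (hB : Function.Injective labB) {i : Fin m}
    {v : JoinVertex VA VB m ℓ}
    (h : (joinGraphMinusB GA GB labA labB ℓ).Adj (pathVertex labA labB ℓ i (ℓ + 1)) v) :
    v = pathVertex labA labB ℓ i ℓ := by
  rw [joinGraphMinusB, SimpleGraph.deleteEdges_adj, joinGraph, SimpleGraph.fromRel_adj,
    pathVertex_last] at h
  obtain ⟨⟨-, h⟩, hn⟩ := h
  rcases h with h | h
  · generalize hx : (Sum.inr (Sum.inr (labB i)) : JoinVertex VA VB m ℓ) = x at h hn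
    cases h <;> simp at hx
    next u w huv =>
      subst hx
      exact (hn ⟨s(labB i, w), huv, by simp⟩).elim
  · generalize hx : (Sum.inr (Sum.inr (labB i)) : JoinVertex VA VB m ℓ) = x at h hn
    cases h <;> simp at hx
    next u w huv =>
      subst hx
      exact (hn ⟨s(u, labB i), huv, by simp [Sym2.eq_swap]⟩).elim
    next j h =>
      subst h
      rw [hB hx]
      rfl
    next j k h =>
      have hk := pathVertex_interior (labA := labA) (labB := labB) j k.2
      rw [h] at hk
      rw [hB hx, hk]

/-- The embedding of `G_A` into `G_ℓ`. -/
def joinInl (GA : SimpleGraph VA) (GB : SimpleGraph VB) (labA : Fin m → VA) (labB : Fin m → VB)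
    (ℓ : ℕ) : GA →g joinGraph GA GB labA labB ℓ where
  toFun := Sum.inl
  map_rel' h := (SimpleGraph.fromRel_adj _ _ _).2 ⟨by simpa using h.ne, .inl (.inA h)⟩

/-- The embedding of `G_B` into `G_ℓ`. -/
def joinInr (GA : SimpleGraph VA) (GB : SimpleGraph VB) (labA : Fin m → VA) (labB : Fin m → VB)
    (ℓ : ℕ) : GB →g joinGraph GA GB labA labB ℓ where
  toFun v := Sum.inr (Sum.inr v)
  map_rel' h := (SimpleGraph.fromRel_adj _ _ _).2 ⟨by simpa using h.ne, .inl (.inB h)⟩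

end PathVertices

/-! ### Confining spread-out fires in `G_ℓ` -/

section SpreadFires

variable {VA VB : Type*} [Fintype VA] [Fintype VB] {GA : SimpleGraph VA} {GB : SimpleGraph VB}

/-- If all fires are inside the connecting paths, away from each other and from the ends, then each
fire burns only one further vertex. At first one firefighter stands just above each fire; the fires
spread one step down; then each firefighter moves to the free vertex below the next fire on its
path. The firefighter above the topmost fire of a path has to go below the lowest one: through
`G_B`, a path without fire, and `G_A`. -/
theorem damage_joinGraph_le_of_spread (hGA : GA.Preconnected) (hGB : GB.Preconnected) {b ℓ : ℕ}
    (labA : Fin (b + 1) → VA) (labB : Fin (b + 1) → VB) (Φ : Finset (Fin (b + 1) × ℕ))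
    (hΦ : Φ.card = b) (hmem : ∀ i k, (i, k) ∈ Φ → 3 ≤ k ∧ k + 1 ≤ ℓ)
    (hgap : ∀ i k k', (i, k) ∈ Φ → (i, k') ∈ Φ → k < k' → k + 3 ≤ k')
    {F : Set (JoinVertex VA VB (b + 1) ℓ)}
    (hF : ∀ v ∈ F, ∃ i k, (i, k) ∈ Φ ∧ v = pathVertex labA labB ℓ i k) :
    damage (joinGraph GA GB labA labB ℓ) F b ≤ 2 * b := by
  classical
  set G := joinGraph GA GB labA labB ℓ with hG
  set pv := pathVertex labA labB ℓ with hpv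
  have hadj : ∀ i k, k ≤ ℓ → G.Adj (pv i k) (pv i (k + 1)) := fun i k hk =>
    joinGraphMinusB_le (joinGraphMinusB_adj_pathVertex i hk)
  -- the fires and the vertices just below them: the only vertices that will burn
  let S : Finset (JoinVertex VA VB (b + 1) ℓ) :=
    Φ.image (fun f => pv f.1 f.2) ∪ Φ.image (fun f => pv f.1 (f.2 - 1))
  have hS : ∀ v, v ∈ S ↔ ∃ i k, (i, k) ∈ Φ ∧ (v = pv i k ∨ v = pv i (k - 1)) := by
    intro v
    simp only [S, Finset.mem_union, Finset.mem_image, Prod.exists]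
    constructor
    · rintro (⟨i, k, h, rfl⟩ | ⟨i, k, h, rfl⟩)
      exacts [⟨i, k, h, .inl rfl⟩, ⟨i, k, h, .inr rfl⟩]
    · rintro ⟨i, k, h, rfl | rfl⟩
      exacts [.inl ⟨i, k, h, rfl⟩, .inr ⟨i, k, h, rfl⟩]
  have hScard : S.card ≤ 2 * b := by
    refine (Finset.card_union_le _ _).trans ?_
    have h1 := Finset.card_image_le (s := Φ) (f := fun f => pv f.1 f.2)
    have h2 := Finset.card_image_le (s := Φ) (f := fun f => pv f.1 (f.2 - 1))
    omega
  have hSpv : ∀ i k, k ≤ ℓ + 1 → pv i k ∈ S → ∃ k', (i, k') ∈ Φ ∧ (k = k' ∨ k = k' - 1) := by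
    intro i k hk h
    obtain ⟨j, k', hj, h | h⟩ := (hS _).1 h
    · obtain ⟨rfl, rfl⟩ :=
        pathVertex_inj_interior hk (by have := hmem _ _ hj; omega) (by have := hmem _ _ hj; omega) h
      exact ⟨_, hj, .inl rfl⟩
    · obtain ⟨rfl, rfl⟩ :=
        pathVertex_inj_interior hk (by have := hmem _ _ hj; omega) (by have := hmem _ _ hj; omega) h
      exact ⟨_, hj, .inr rfl⟩
  have hSA : ∀ x : VA, Sum.inl x ∉ S := by
    intro x hx
    obtain ⟨j, k, hj, h⟩ := (hS _).1 hx
    have hk := hmem _ _ hj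
    obtain ⟨c, rfl⟩ : ∃ c, k = c + 2 := ⟨k - 2, by omega⟩
    rcases h with h | h
    · rw [hpv, pathVertex_interior j (k := c + 1) (by omega)] at h
      simp at h
    · rw [hpv, Nat.add_sub_assoc (by omega), pathVertex_interior j (k := c) (by omega)] at h
      simp at h
  have hSB : ∀ x : VB, Sum.inr (Sum.inr x) ∉ S := by
    intro x hx
    obtain ⟨j, k, hj, h⟩ := (hS _).1 hx
    have hk := hmem _ _ hj
    obtain ⟨c, rfl⟩ : ∃ c, k = c + 2 := ⟨k - 2, by omega⟩
    rcases h with h | h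
    · rw [hpv, pathVertex_interior j (k := c + 1) (by omega)] at h
      simp at h
    · rw [hpv, Nat.add_sub_assoc (by omega), pathVertex_interior j (k := c) (by omega)] at h
      simp at h
  have habove : ∀ i k, (i, k) ∈ Φ → pv i (k + 1) ∉ S := by
    intro i k hk h
    have h0 := hmem _ _ hk
    obtain ⟨k', hk', h1⟩ := hSpv i _ (by omega) h
    have h2 := hmem _ _ hk'
    have := hgap i k k' hk hk' (by omega)
    omega
  have hbelow : ∀ i k, (i, k) ∈ Φ → pv i (k - 2) ∉ S := by
    intro i k hk h
    have h0 := hmem _ _ hk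
    obtain ⟨k', hk', h1⟩ := hSpv i _ (by omega) h
    have h2 := hmem _ _ hk'
    have := hgap i k' k hk' hk (by omega)
    omega
  -- the fire after a given one, in the cyclic order on each path
  choose s hs1 hs2 hs3 using fun i => exists_cyclic_succ ((Φ.filter (·.1 = i)).image Prod.snd)
  have hrow : ∀ i k, k ∈ (Φ.filter (·.1 = i)).image Prod.snd ↔ (i, k) ∈ Φ := by
    intro i k
    simp
  simp only [hrow] at hs1 hs2 hs3
  let nxt : Φ → Φ := fun f => ⟨(f.1.1, s f.1.1 f.1.2), hs1 _ _ f.2⟩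
  have hnxt : Function.Surjective nxt := by
    refine Finite.surjective_of_injective fun f g hfg => ?_
    have hv : (nxt f).1 = (nxt g).1 := congrArg Subtype.val hfg
    have h1 : f.1.1 = g.1.1 := (congrArg Prod.fst hv :)
    have h2 : s f.1.1 f.1.2 = s g.1.1 g.1.2 := (congrArg Prod.snd hv :)
    rw [← h1] at h2
    exact Subtype.ext (Prod.ext h1 (hs2 _ _ f.2 _ (h1 ▸ g.2) h2))
  let e : Fin b ≃ Φ := (Φ.equivFinOfCardEq hΦ).symm
  let p : Placement (JoinVertex VA VB (b + 1) ℓ) b := fun t j =>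
    if t = 0 then pv (e j).1.1 ((e j).1.2 + 1) else pv (nxt (e j)).1.1 ((nxt (e j)).1.2 - 2)
  have hburnt : ∀ t, burnt G F p t ⊆ S := by
    have hFS : ∀ v ∈ F, v ∈ S := fun v hv => by
      obtain ⟨i, k, hik, rfl⟩ := hF v hv
      exact (hS _).2 ⟨i, k, hik, .inl rfl⟩
    intro t
    induction t with
    | zero => exact hFS
    | succ t ih =>
      rintro v (hv | ⟨hv, u, hu, huv⟩)
      · exact ih hv
      have hup : ∀ i k, (i, k) ∈ Φ → v ≠ pv i (k + 1) := by
        rintro i k hik rfl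
        exact hv ⟨0, Nat.zero_le _, e.symm ⟨_, hik⟩, by simp [p]⟩
      -- the vertices below the second burnt vertex of each fire are protected from turn 1 on
      have hdown : t ≠ 0 → ∀ i k, (i, k) ∈ Φ → v ≠ pv i (k - 2) := by
        rintro ht i k hik rfl
        obtain ⟨f, hf⟩ := hnxt ⟨_, hik⟩
        exact hv ⟨1, by omega, e.symm f, by simp [p, hf]⟩
      have hfire : ∀ i k, (i, k) ∈ Φ → u = pv i k → v ∈ S := by
        rintro i k hik rfl
        have h0 := hmem _ _ hik
        rcases eq_or_eq_of_adj_pathVertex (by omega) (by omega) huv with h | h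
        · exact (hS _).2 ⟨i, k, hik, .inr h⟩
        · exact (hup i k hik h).elim
      by_cases ht : t = 0
      · subst ht
        obtain ⟨i, k, hik, h⟩ := hF u hu
        exact hfire i k hik h
      · obtain ⟨i, k, hik, h | h⟩ := (hS _).1 (ih hu)
        · exact hfire i k hik h
        · subst h
          have h0 := hmem _ _ hik
          rcases eq_or_eq_of_adj_pathVertex (by omega) (by omega) huv with h | h
          · exact (hdown ht i k hik h).elim
          · rw [Nat.sub_add_cancel (by omega)] at h
            exact (hS _).2 ⟨i, k, hik, .inl h⟩
  have hlegal : IsLegal G F ⊤ p := by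
    refine ⟨fun j h => ?_, fun t j => ?_⟩
    · have := hburnt 0 h
      simp only [p, if_true] at this
      exact habove _ _ (e j).2 this
    refine CanMove.anti (hburnt (t + 1)) ?_
    by_cases ht : t = 0
    swap
    · simp only [p, ht, if_false, Nat.add_eq_zero_iff, false_and]
      exact .refl (hbelow _ _ (nxt (e j)).2)
    simp only [p, ht, if_true, zero_add, one_ne_zero, if_false]
    obtain ⟨⟨i, k⟩, hik⟩ := e j
    have hik' := hs1 i k hik
    have h0 := hmem _ _ hik
    have h0' := hmem _ _ hik'
    rcases hs3 i k hik with ⟨h1, h2⟩ | h1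
    · have := hgap _ _ _ hik hik' h1
      refine CanMove.of_seq (pv i) (m := k + 1) (n := s i k - 2) (by omega)
        (fun c _ _ => hadj i c (by omega)) fun c hc hc' hcS => ?_
      obtain ⟨k', hk', h3⟩ := hSpv i c (by omega) hcS
      have := h2 k' hk'
      omega
    -- the fire is the topmost of its path, the next one the lowest; `j` is a path without fire
    · obtain ⟨j, hj⟩ : ∃ j, ∀ c, (j, c) ∉ Φ := by
        by_contra! hcon
        choose c hc using hcon
        have := Finset.card_le_card_of_injOn (s := Finset.univ) (t := Φ)
          (fun j => (j, c j)) (fun j _ => hc j) (fun j _ j' _ h => congrArg Prod.fst h)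
        simp [hΦ] at this
      have w1 : CanMove G S ⊤ (pv i (k + 1)) (pv i (ℓ + 1)) := by
        refine CanMove.of_seq (pv i) (by omega)
          (fun c _ _ => hadj i c (by omega)) fun c hc hc' hcS => ?_
        obtain ⟨k', hk', h3⟩ := hSpv i c (by omega) hcS
        have := h1 k' hk'
        omega
      have w2 : CanMove G S ⊤ (pv i (ℓ + 1)) (pv j (ℓ + 1)) := by
        rw [hpv, pathVertex_last, pathVertex_last]
        exact CanMove.of_hom (joinInr GA GB labA labB ℓ) hGB hSB _ _
      have w3 : CanMove G S ⊤ (pv j 0) (pv j (ℓ + 1)) := by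
        refine CanMove.of_seq (pv j) (by omega)
          (fun c _ _ => hadj j c (by omega)) fun c hc hc' hcS => ?_
        obtain ⟨k', hk', h3⟩ := hSpv j c (by omega) hcS
        exact hj _ hk'
      have w4 : CanMove G S ⊤ (pv j 0) (pv i 0) :=
        CanMove.of_hom (joinInl GA GB labA labB ℓ) hGA hSA _ _
      have w5 : CanMove G S ⊤ (pv i 0) (pv i (s i k - 2)) := by
        refine CanMove.of_seq (pv i) (by omega)
          (fun c _ _ => hadj i c (by omega)) fun c hc hc' hcS => ?_
        obtain ⟨k', hk', h3⟩ := hSpv i c (by omega) hcS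
        have := h1 k' hk'
        omega
      exact w1.trans (w2.trans (w3.symm.trans (w4.trans w5)))
  have := card_le_dprmvs_add hlegal S hburnt
  rw [damage]
  omega

end SpreadFires

/-! ### The total damage in `G_ℓ` -/

section TypicalFires

variable {VA VB : Type*} [Fintype VA] [Fintype VB] {GA : SimpleGraph VA} {GB : SimpleGraph VB}

theorem card_joinVertex (m ℓ : ℕ) :
    Fintype.card (JoinVertex VA VB m ℓ) = Fintype.card VA + (m * ℓ + Fintype.card VB) := by
  simp

/-- All but a proportion `O(1 / ℓ)` of the sets of `b` fires are spread out, and the others burn at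
most the whole graph. -/
theorem sum_damage_joinGraph_le (hGA : GA.Preconnected) (hGB : GB.Preconnected) {b ℓ : ℕ}
    (hb : 1 ≤ b) (labA : Fin (b + 1) → VA) (labB : Fin (b + 1) → VB) :
    ∑ F ∈ (Finset.univ : Finset (JoinVertex VA VB (b + 1) ℓ)).powersetCard b,
        damage (joinGraph GA GB labA labB ℓ) (F : Set (JoinVertex VA VB (b + 1) ℓ)) b ≤
      Fintype.card (JoinVertex VA VB (b + 1) ℓ) ^ b *
        (Fintype.card VA + Fintype.card VB + (b + 1) * 3 + (b - 1) * 2 + 2 * b) := by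
  classical
  set pv := pathVertex labA labB ℓ with hpv
  -- the vertices too close to an end of a path, with those of `G_A` and `G_B`
  let S : Finset (JoinVertex VA VB (b + 1) ℓ) :=
    Finset.univ.image Sum.inl ∪ Finset.univ.image (fun x => Sum.inr (Sum.inr x)) ∪
      (Finset.univ : Finset (Fin (b + 1) × Fin 3)).image fun x => pv x.1 (![1, 2, ℓ] x.2)
  have hSA : ∀ x, Sum.inl x ∈ S := fun x => by simp [S]
  have hSB : ∀ x, Sum.inr (Sum.inr x) ∈ S := fun x => by simp [S]
  have hSpv : ∀ i (j : Fin 3), pv i (![1, 2, ℓ] j) ∈ S := fun i j =>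
    Finset.mem_union_right _ (Finset.mem_image_of_mem
      (fun x : Fin (b + 1) × Fin 3 => pv x.1 (![1, 2, ℓ] x.2)) (Finset.mem_univ (i, j)))
  have hScard : S.card ≤ Fintype.card VA + Fintype.card VB + (b + 1) * 3 := by
    refine (Finset.card_union_le _ _).trans (Nat.add_le_add
      ((Finset.card_union_le _ _).trans (Nat.add_le_add ?_ ?_)) ?_)
    · exact Finset.card_image_le
    · exact Finset.card_image_le
    · refine Finset.card_image_le.trans ?_
      simp
  -- `N v` holds the next two vertices after an internal vertex `v`, which is number `k + 1` of its
  -- path if its index in `Fin ℓ` is `k`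
  let N : JoinVertex VA VB (b + 1) ℓ → Finset (JoinVertex VA VB (b + 1) ℓ) := fun v =>
    match v with
    | Sum.inr (Sum.inl (i, k)) => {pv i (k + 2), pv i (k + 3)}
    | _ => ∅
  have hN : ∀ v, (N v).card ≤ 2 := by
    rintro (x | ⟨i, k⟩ | x)
    exacts [by simp [N], Finset.card_le_two, by simp [N]]
  have hNpv : ∀ i k, 1 ≤ k → k ≤ ℓ → N (pv i k) = {pv i (k + 1), pv i (k + 2)} := by
    intro i k h1 h2
    obtain ⟨k, rfl⟩ := Nat.exists_eq_add_of_le' h1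
    conv_lhs => rw [hpv, pathVertex_interior i h2]
  have hgood : ∀ F : Finset (JoinVertex VA VB (b + 1) ℓ), F.card = b →
      (¬ ∃ v ∈ F, v ∈ S ∨ ∃ u ∈ F, u ≠ v ∧ v ∈ N u) →
      damage (joinGraph GA GB labA labB ℓ) (F : Set (JoinVertex VA VB (b + 1) ℓ)) b ≤ 2 * b := by
    intro F hF hno
    push Not at hno
    let Φ := ((Finset.univ : Finset (Fin (b + 1))) ×ˢ Finset.Icc 1 ℓ).filter fun f => pv f.1 f.2 ∈ F
    have hΦ : ∀ i k, (i, k) ∈ Φ ↔ (1 ≤ k ∧ k ≤ ℓ) ∧ pv i k ∈ F := by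
      intro i k
      simp [Φ]
    have himg : F = Φ.image fun f => pv f.1 f.2 := by
      ext v
      simp only [Finset.mem_image, Prod.exists]
      constructor
      · intro hv
        rcases v with x | ⟨i, k⟩ | x
        · exact ((hno _ hv).1 (hSA x)).elim
        · have hk : pv i (k + 1) = _ := pathVertex_interior i k.2
          exact ⟨i, k + 1, (hΦ _ _).2 ⟨by omega, hk ▸ hv⟩, hk⟩
        · exact ((hno _ hv).1 (hSB x)).elim
      · rintro ⟨i, k, h, rfl⟩
        exact ((hΦ _ _).1 h).2
    have hinj : Set.InjOn (fun f : Fin (b + 1) × ℕ => pv f.1 f.2) Φ := by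
      rintro ⟨i, k⟩ hf ⟨j, k'⟩ hf' h
      have h1 := ((hΦ _ _).1 hf).1
      have h2 := ((hΦ _ _).1 hf').1
      obtain ⟨rfl, rfl⟩ := pathVertex_inj_interior (by omega) h2.1 h2.2 h
      rfl
    refine damage_joinGraph_le_of_spread hGA hGB labA labB Φ ?_ ?_ ?_ ?_
    · have h := congrArg Finset.card himg
      rw [Finset.card_image_of_injOn hinj, hF] at h
      exact h.symm
    · intro i k hik
      obtain ⟨hk, hv⟩ := (hΦ _ _).1 hik
      have hn := (hno _ hv).1
      have h0 : k ≠ 1 := by rintro rfl; exact hn (hSpv i 0)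
      have h1 : k ≠ 2 := by rintro rfl; exact hn (hSpv i 1)
      have h2 : k ≠ ℓ := by rintro rfl; exact hn (hSpv i 2)
      omega
    · intro i k k' hk hk' hlt
      obtain ⟨h1, hv⟩ := (hΦ _ _).1 hk
      obtain ⟨h2, hv'⟩ := (hΦ _ _).1 hk'
      have hne : pv i k ≠ pv i k' := fun h => by
        have := pathVertex_inj_interior (by omega) h2.1 h2.2 h
        omega
      have hn := (hno _ hv').2 _ hv hne
      rw [hNpv i k h1.1 h1.2, Finset.mem_insert, Finset.mem_singleton, not_or] at hn
      have h3 : k' ≠ k + 1 := by rintro rfl; exact hn.1 rfl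
      have h4 : k' ≠ k + 2 := by rintro rfl; exact hn.2 rfl
      omega
    · intro v hv
      rw [Finset.mem_coe, himg] at hv
      obtain ⟨f, hf, rfl⟩ := Finset.mem_image.1 hv
      exact ⟨f.1, f.2, hf, rfl⟩
  rw [← Finset.sum_filter_add_sum_filter_not _
    (fun F => ∃ v ∈ F, v ∈ S ∨ ∃ u ∈ F, u ≠ v ∧ v ∈ N u), Nat.mul_add]
  generalize hn : Fintype.card (JoinVertex VA VB (b + 1) ℓ) = n
  refine Nat.add_le_add ?_ ?_
  · refine (Finset.sum_le_card_nsmul _ _ n fun F _ => hn ▸ Nat.sub_le _ _).trans ?_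
    rw [smul_eq_mul, ← pow_sub_one_mul (by omega : b ≠ 0) n, mul_right_comm, ← hn]
    refine Nat.mul_le_mul_right _ ((card_le_of_forall_exists hb S N hN _ fun F hF => ?_).trans
      (Nat.mul_le_mul_left _ (Nat.add_le_add_right hScard _)))
    exact (Finset.mem_filter.1 hF).imp (fun h => (Finset.mem_powersetCard.1 h).2) id
  · refine (Finset.sum_le_card_nsmul _ _ (2 * b) fun F hF => ?_).trans ?_
    · obtain ⟨hF, hno⟩ := Finset.mem_filter.1 hF
      exact hgood F (Finset.mem_powersetCard.1 hF).2 hno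
    · rw [smul_eq_mul]
      refine Nat.mul_le_mul_right _ ((Finset.card_filter_le _ _).trans ?_)
      rw [Finset.card_powersetCard, Finset.card_univ, hn]
      exact Nat.choose_le_pow _ _

end TypicalFires

/-! ### Uncontrollable fires in `G_ℓ - E(G_B)` -/

section PendantPaths

variable {VA VB : Type*} [Fintype VA] [Fintype VB] {GA : SimpleGraph VA} {GB : SimpleGraph VB}

/-- One fire in the middle third of each of `b` of the paths splits `G_ℓ - E(G_B)` into the `b`
outer ends of these paths and a central region. Some region has no firefighter on turn `0`, hence
never has one, and a third of a path burns there. -/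
theorem le_damage_joinGraphMinusB {b ℓ q : ℕ} (hb : 1 ≤ b) (hq : 3 * q ≤ ℓ)
    (labA : Fin (b + 1) → VA) {labB : Fin (b + 1) → VB} (hB : Function.Injective labB)
    (x : Fin b → ℕ) (hx : ∀ i, q < x i ∧ x i ≤ 2 * q) {F : Set (JoinVertex VA VB (b + 1) ℓ)}
    (hF : ∀ v, v ∈ F ↔ ∃ i, v = pathVertex labA labB ℓ (Fin.castSucc i) (x i)) :
    q ≤ damage (joinGraphMinusB GA GB labA labB ℓ) F b := by
  classical
  set G := joinGraphMinusB GA GB labA labB ℓ with hG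
  set pv := pathVertex labA labB ℓ with hpv
  have hadj : ∀ i k, k ≤ ℓ → G.Adj (pv i k) (pv i (k + 1)) := fun i k hk =>
    joinGraphMinusB_adj_pathVertex i hk
  have hnbr : ∀ i k v, 1 ≤ k → k ≤ ℓ + 1 → G.Adj (pv i k) v →
      v = pv i (k - 1) ∨ k ≤ ℓ ∧ v = pv i (k + 1) := by
    intro i k v h1 h2 h
    rcases h2.eq_or_lt with rfl | h2
    · exact .inl (eq_of_joinGraphMinusB_adj_last hB h)
    · rcases eq_or_eq_of_adj_pathVertex h1 (by omega) (joinGraphMinusB_le h) with h | h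
      exacts [.inl h, .inr ⟨by omega, h⟩]
  suffices dprmvs G F b ⊤ + q ≤ Fintype.card (JoinVertex VA VB (b + 1) ℓ) by
    rw [damage]
    omega
  refine dprmvs_add_le ?_ fun p hp => ?_
  · rw [card_joinVertex]
    nlinarith
  have hcard : ∀ i (c : ℕ → ℕ), Set.InjOn c (Finset.Icc 1 q) →
      (∀ n ∈ Finset.Icc 1 q, 1 ≤ c n ∧ c n ≤ ℓ) →
      q ≤ ((Finset.Icc 1 q).image fun n => pv i (c n)).card := by
    intro i c hc hcl
    rw [Finset.card_image_of_injOn, Nat.card_Icc, Nat.add_sub_cancel]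
    intro n hn n' hn' h
    have h1 := hcl n hn
    have h2 := hcl n' hn'
    exact hc hn hn' (pathVertex_inj_interior (by omega) h2.1 h2.2 h).2
  -- the outer end of the `i`-th path, beyond the fire
  let O : Fin b → Set (JoinVertex VA VB (b + 1) ℓ) := fun i =>
    {v | ∃ k, x i < k ∧ k ≤ ℓ + 1 ∧ v = pv (Fin.castSucc i) k}
  by_cases hO : ∀ i, ∃ j, p 0 j ∈ O i
  · choose g hg using hO
    -- the outer ends are disjoint, so they use up all `b` firefighters, and none is in the centre `C`
    have hginj : Function.Injective g := by
      intro i i' h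
      obtain ⟨k, hk, hk1, h1⟩ := hg i
      obtain ⟨k', hk', hk2, h2⟩ := hg i'
      rw [h, h2] at h1
      exact (Fin.castSucc_injective b (pathVertex_inj hB hk2 (by omega) hk1 h1).1).symm
    have hgsurj := Finite.surjective_of_injective hginj
    let C : Set (JoinVertex VA VB (b + 1) ℓ) := {v | v ∉ F ∧ ∀ i, v ∉ O i}
    have hC : ∀ u ∈ C, ∀ v, G.Adj u v → v ∈ C ∨ v ∈ F := by
      intro u hu v huv
      by_contra! hv
      obtain ⟨hvC, hvF⟩ := hv
      obtain ⟨i, k, hk, hkl, rfl⟩ : ∃ i, v ∈ O i := by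
        by_contra! h
        exact hvC ⟨hvF, h⟩
      rcases hnbr _ k u (by omega) hkl huv.symm with rfl | ⟨h1, rfl⟩
      · rcases (show x i ≤ k - 1 by omega).eq_or_lt with h | h
        · exact hu.1 ((hF _).2 ⟨i, by rw [h]⟩)
        · exact hu.2 i ⟨k - 1, h, by omega, rfl⟩
      · exact hu.2 i ⟨k + 1, by omega, by omega, rfl⟩
    have hC0 : ∀ j, p 0 j ∉ C := by
      intro j hj
      obtain ⟨i, rfl⟩ := hgsurj j
      exact hj.2 i (hg i)
    have hpC := hp.notMem_of_enclosed hC hC0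
    let i0 : Fin b := ⟨0, hb⟩
    have hx0 := hx i0
    refine ⟨(Finset.Icc 1 q).image fun n => pv (Fin.castSucc i0) (x i0 - n),
      hcard _ _ ?_ ?_, ?_⟩
    · intro n hn n' hn' h
      simp only [Finset.coe_Icc, Set.mem_Icc] at hn hn' h
      omega
    · intro n hn
      rw [Finset.mem_Icc] at hn
      omega
    intro v hv
    obtain ⟨n, hn, rfl⟩ := Finset.mem_image.1 hv
    rw [Finset.mem_Icc] at hn
    refine ⟨n, mem_burnt_of_seq hpC (fun n => pv (Fin.castSucc i0) (x i0 - n)) ?_ n ?_⟩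
    · exact (hF _).2 ⟨i0, rfl⟩
    · intro k hk
      have hk1 : x i0 - k = x i0 - (k + 1) + 1 := by omega
      refine ⟨?_, fun h => ?_, ?_⟩
      · rw [hk1]
        exact (hadj _ _ (by omega)).symm
      · obtain ⟨i, h⟩ := (hF _).1 h
        have hxi := hx i
        obtain ⟨h1, h2⟩ := pathVertex_inj hB (by omega) (by omega) (by omega) h
        obtain rfl := Fin.castSucc_injective b h1
        omega
      · rintro i ⟨k', hk', hkl, h⟩
        obtain ⟨h1, h2⟩ := pathVertex_inj hB (by omega) (by omega) (by omega) h
        obtain rfl := Fin.castSucc_injective b h1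
        omega
  · push Not at hO
    obtain ⟨i, hi⟩ := hO
    have hxi := hx i
    have hC : ∀ u ∈ O i, ∀ v, G.Adj u v → v ∈ O i ∨ v ∈ F := by
      rintro u ⟨k, hk, hkl, rfl⟩ v huv
      rcases hnbr _ k v (by omega) hkl huv with rfl | ⟨h1, rfl⟩
      · rcases (show x i ≤ k - 1 by omega).eq_or_lt with h | h
        · exact .inr ((hF _).2 ⟨i, by rw [h]⟩)
        · exact .inl ⟨k - 1, h, by omega, rfl⟩
      · exact .inl ⟨k + 1, by omega, by omega, rfl⟩
    have hpC := hp.notMem_of_enclosed hC hi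
    refine ⟨(Finset.Icc 1 q).image fun n => pv (Fin.castSucc i) (x i + n),
      hcard _ _ ?_ ?_, ?_⟩
    · intro n hn n' hn' h
      exact Nat.add_left_cancel h
    · intro n hn
      rw [Finset.mem_Icc] at hn
      omega
    intro v hv
    obtain ⟨n, hn, rfl⟩ := Finset.mem_image.1 hv
    rw [Finset.mem_Icc] at hn
    refine ⟨n, mem_burnt_of_seq hpC (fun n => pv (Fin.castSucc i) (x i + n)) ?_ n ?_⟩
    · exact (hF _).2 ⟨i, rfl⟩
    · intro k hk
      exact ⟨hadj _ _ (by omega), x i + (k + 1), by omega, by omega, rfl⟩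

/-- There are `q ^ b` ways to place one fire in the middle third of each of the first `b` paths. -/
theorem pow_le_sum_damage_joinGraphMinusB {b ℓ q : ℕ} (hb : 1 ≤ b) (hq : 3 * q ≤ ℓ)
    (labA : Fin (b + 1) → VA) {labB : Fin (b + 1) → VB} (hB : Function.Injective labB) :
    q ^ (b + 1) ≤ ∑ F ∈ (Finset.univ : Finset (JoinVertex VA VB (b + 1) ℓ)).powersetCard b,
      damage (joinGraphMinusB GA GB labA labB ℓ) (F : Set (JoinVertex VA VB (b + 1) ℓ)) b := by
  classical
  let fires : (Fin b → Fin q) → Finset (JoinVertex VA VB (b + 1) ℓ) := fun y =>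
    Finset.univ.image fun i => pathVertex labA labB ℓ (Fin.castSucc i) (q + 1 + y i)
  have hpv : ∀ (y y' : Fin b → Fin q) i i',
      pathVertex labA labB ℓ (Fin.castSucc i) (q + 1 + y i) =
        pathVertex labA labB ℓ (Fin.castSucc i') (q + 1 + y' i') → i = i' ∧ y i = y' i' := by
    intro y y' i i' h
    have h1 := (y i).2
    have h2 := (y' i').2
    obtain ⟨h3, h4⟩ := pathVertex_inj_interior (by omega) (by omega) (by omega) h
    exact ⟨Fin.castSucc_injective b h3, Fin.ext (by omega)⟩
  have hinj : Function.Injective fires := by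
    intro y y' h
    funext i
    have hi : pathVertex labA labB ℓ (Fin.castSucc i) (q + 1 + y i) ∈ fires y' :=
      h ▸ Finset.mem_image_of_mem _ (Finset.mem_univ i)
    obtain ⟨i', -, hi'⟩ := Finset.mem_image.1 hi
    obtain ⟨rfl, h2⟩ := hpv _ _ _ _ hi'
    exact h2.symm
  have hsub : Finset.univ.image fires ⊆
      (Finset.univ : Finset (JoinVertex VA VB (b + 1) ℓ)).powersetCard b := by
    intro F hF
    obtain ⟨y, -, rfl⟩ := Finset.mem_image.1 hF
    refine Finset.mem_powersetCard.2 ⟨Finset.subset_univ _, ?_⟩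
    rw [Finset.card_image_of_injective _ fun i i' h => (hpv y y i i' h).1, Finset.card_univ,
      Fintype.card_fin]
  refine le_trans ?_ (Finset.sum_le_sum_of_subset hsub)
  refine le_trans ?_ (Finset.card_nsmul_le_sum _ _ q ?_)
  · rw [Finset.card_image_of_injective _ hinj, Finset.card_univ]
    simp [pow_succ]
  · intro F hF
    obtain ⟨y, -, rfl⟩ := Finset.mem_image.1 hF
    refine le_damage_joinGraphMinusB hb hq labA hB (fun i => q + 1 + y i) (fun i => ?_) fun v => ?_
    · have := (y i).2
      omega
    · simp [fires, eq_comm]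

end PendantPaths

end Firefighter

theorem mainTheorem5 {VA VB : Type*} [Fintype VA] [Fintype VB] (b : ℕ) (hb : 1 ≤ b)
    (GA : SimpleGraph VA) (GB : SimpleGraph VB) (hGA : GA.Connected) (hGB : GB.Connected)
    (labA : Fin (b + 1) ↪ VA) (labB : Fin (b + 1) ≃ VB) :
    (∀ᶠ ℓ : ℕ in Filter.atTop,
      Firefighter.expectedDamagePR (Firefighter.joinGraph GA GB labA labB ℓ) b b ⊤ <
        Firefighter.expectedDamagePR (Firefighter.joinGraphMinusB GA GB labA labB ℓ) b b ⊤) ∧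
    Filter.Tendsto
      (fun ℓ : ℕ =>
        Firefighter.expectedDamagePR (Firefighter.joinGraphMinusB GA GB labA labB ℓ) b b ⊤ /
          Firefighter.expectedDamagePR (Firefighter.joinGraph GA GB labA labB ℓ) b b ⊤)
      Filter.atTop Filter.atTop ∧
    Asymptotics.IsBigO Filter.atTop
      (fun ℓ : ℕ =>
        ((Fintype.card (Firefighter.JoinVertex VA VB (b + 1) ℓ)).choose b : ℝ) *
          Firefighter.expectedDamagePR (Firefighter.joinGraph GA GB labA labB ℓ) b b ⊤)
      (fun ℓ : ℕ => (ℓ : ℝ) ^ b) ∧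
    Asymptotics.IsBigO Filter.atTop
      (fun ℓ : ℕ => (ℓ : ℝ) ^ (b + 1))
      (fun ℓ : ℕ =>
        ((Fintype.card (Firefighter.JoinVertex VA VB (b + 1) ℓ)).choose b : ℝ) *
          Firefighter.expectedDamagePR (Firefighter.joinGraphMinusB GA GB labA labB ℓ) b b ⊤) := by
  have hbn : ∀ ℓ, b ≤ Fintype.card (Firefighter.JoinVertex VA VB (b + 1) ℓ) := fun ℓ => by
    rw [Firefighter.card_joinVertex, ← Fintype.card_congr labB, Fintype.card_fin]
    omega
  set E₁ : ℕ → ℝ := fun ℓ =>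
    Firefighter.expectedDamagePR (Firefighter.joinGraph GA GB labA labB ℓ) b b ⊤ with hE₁
  set E₂ : ℕ → ℝ := fun ℓ =>
    Firefighter.expectedDamagePR (Firefighter.joinGraphMinusB GA GB labA labB ℓ) b b ⊤ with hE₂
  set c : ℕ → ℝ := fun ℓ =>
    ((Fintype.card (Firefighter.JoinVertex VA VB (b + 1) ℓ)).choose b : ℝ) with hc
  have hc0 : ∀ ℓ, 0 < c ℓ := fun ℓ => Nat.cast_pos.2 (Nat.choose_pos (hbn ℓ))
  -- positivity of the denominator: a ratio with `E₁ ℓ = 0` would have the junk value `0`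
  have hE₁0 : ∀ ℓ, 0 < E₁ ℓ := fun ℓ =>
    pos_of_mul_pos_right (Firefighter.choose_mul_expectedDamagePR_pos _ hb (hbn ℓ)) (hc0 ℓ).le
  obtain ⟨K, hK, hupper⟩ : ∃ K : ℝ, 0 < K ∧ ∀ ℓ : ℕ, 1 ≤ ℓ → c ℓ * E₁ ℓ ≤ K * (ℓ : ℝ) ^ b := by
    refine ⟨((Fintype.card VA + (b + 1) + Fintype.card VB) ^ b *
      (Fintype.card VA + Fintype.card VB + (b + 1) * 3 + (b - 1) * 2 + 2 * b) : ℕ), ?_,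
      fun ℓ hℓ => ?_⟩
    · rw [Nat.cast_pos]
      positivity
    · simp only [hc, hE₁]
      rw [Firefighter.choose_mul_expectedDamagePR _ (hbn ℓ), ← Nat.cast_pow, ← Nat.cast_mul,
        Nat.cast_le]
      refine (Firefighter.sum_damage_joinGraph_le hGA.preconnected hGB.preconnected hb
        labA labB).trans ?_
      rw [Firefighter.card_joinVertex, mul_right_comm, ← mul_pow]
      gcongr
      nlinarith [Nat.zero_le (Fintype.card VA), Nat.zero_le (Fintype.card VB)]
  have hlower : ∀ ℓ : ℕ, 3 ≤ ℓ → (1 / 5 : ℝ) ^ (b + 1) * (ℓ : ℝ) ^ (b + 1) ≤ c ℓ * E₂ ℓ := by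
    intro ℓ hℓ
    simp only [hc, hE₂]
    rw [Firefighter.choose_mul_expectedDamagePR _ (hbn ℓ), ← mul_pow]
    have h1 := Firefighter.pow_le_sum_damage_joinGraphMinusB (GA := GA) (GB := GB) hb
      (Nat.mul_div_le ℓ 3) labA labB.injective
    refine le_trans ?_ (Nat.cast_le.2 h1)
    rw [Nat.cast_pow]
    -- rounding down costs at most the factor `5 / 3`, attained at `ℓ = 5`
    have h2 : (ℓ : ℝ) ≤ 5 * ((ℓ / 3 : ℕ) : ℝ) := by
      exact_mod_cast (by omega : ℓ ≤ 5 * (ℓ / 3))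
    gcongr
    linarith
  have hratio : Filter.Tendsto (fun ℓ => E₂ ℓ / E₁ ℓ) Filter.atTop Filter.atTop := by
    have hlin : Filter.Tendsto (fun ℓ : ℕ => (1 / 5 : ℝ) ^ (b + 1) / K * (ℓ : ℝ))
        Filter.atTop Filter.atTop :=
      tendsto_natCast_atTop_atTop.const_mul_atTop (by positivity)
    refine Filter.tendsto_atTop_mono' _ ?_ hlin
    filter_upwards [Filter.eventually_ge_atTop 3] with ℓ hℓ
    have h1 := hupper ℓ (by omega)
    have h2 := hlower ℓ hℓ
    rw [← mul_div_mul_left (E₂ ℓ) _ (hc0 ℓ).ne', le_div_iff₀ (mul_pos (hc0 ℓ) (hE₁0 ℓ))]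
    calc (1 / 5 : ℝ) ^ (b + 1) / K * ℓ * (c ℓ * E₁ ℓ)
        ≤ (1 / 5 : ℝ) ^ (b + 1) / K * ℓ * (K * (ℓ : ℝ) ^ b) := by gcongr
      _ = (1 / 5 : ℝ) ^ (b + 1) * (ℓ : ℝ) ^ (b + 1) := by
          field_simp
          ring
      _ ≤ _ := h2
  refine ⟨?_, hratio, ?_, ?_⟩
  · filter_upwards [hratio.eventually_gt_atTop 1] with ℓ hℓ
    exact (one_lt_div (hE₁0 ℓ)).1 hℓ
  · refine Asymptotics.IsBigO.of_bound K ?_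
    filter_upwards [Filter.eventually_ge_atTop 1] with ℓ hℓ
    rw [Real.norm_of_nonneg (mul_pos (hc0 ℓ) (hE₁0 ℓ)).le, Real.norm_of_nonneg (by positivity)]
    exact hupper ℓ hℓ
  · refine Asymptotics.IsBigO.of_bound (5 ^ (b + 1)) ?_
    filter_upwards [Filter.eventually_ge_atTop 3] with ℓ hℓ
    rw [Real.norm_of_nonneg (by positivity)]
    calc (ℓ : ℝ) ^ (b + 1) = 5 ^ (b + 1) * ((1 / 5) ^ (b + 1) * (ℓ : ℝ) ^ (b + 1)) := by
          rw [← mul_assoc, ← mul_pow]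
          norm_num
      _ ≤ 5 ^ (b + 1) * (c ℓ * E₂ ℓ) := by
          exact mul_le_mul_of_nonneg_left (hlower ℓ hℓ) (by positivity)
      _ ≤ _ := mul_le_mul_of_nonneg_left (le_abs_self _) (by positivity)
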